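/- Let $q\colon E\to M$ be a smooth real vector bundle of finite rank over a smooth (finite-dimensional, Hausdorff, boundaryless) manifold $M$. The tangent bundle $TE$ carries, besides $TE\to E$, the vector bundle structure $Tq\colon TE\to TM$ whose fibrewise addition $+_{TM}=T(+)\colon TE\times_{TM}TE=T(E\times_ME)\to TE$ is the tangent map of the fibrewise addition $+\colon E\times_M E\to E$, and whose scalar multiplication by $a\in\mathbb R$ is the tangent map of multiplication by $a$ on $E$. Let $\chi$ be a linear vector field on $E$ over $X\in\mathfrak X(M)$, i.e. a smooth vector field $\chi\colon E\to TE$ that is a morphism of vector bundles from $q\colon E\to M$ to $Tq\colon TE\to TM$ over $X\colon M\to TM$: $Tq\circ\chi=X\circ q$, $\chi(e_1+e_2)=\chi(e_1)+_{TM}\chi(e_2)$ and $\chi(ae)=a\cdot_{TM}\chi(e)$ for all $e,e_1,e_2$ with $e_1,e_2$ in the same fibre of $E$ and all $a\in\mathbb R$. Let $\phi\colon\Omega\to M$ be the maximal flow of $X$: $\Omega\subseteq\mathbb R\times M$ is the set of all $(t,x)$ for which there is an integral curve $\gamma$ of $X$ with $\gamma(0)=x$ defined on an open interval containing $0$ and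 $t$, and then $\phi_t(x)=\phi(t,x)=\gamma(t)$. Let $\Phi\colon\widetilde\Omega\to E$ be the maximal flow of $\chi$, defined in the same way. For $t\in\mathbb R$ set $M_t:=\{x\in M\mid (t,x)\in\Omega\}$. Then $$\widetilde\Omega=\{(t,e)\in\mathbb R\times E\mid (t,q(e))\in\Omega\},$$ and for every $t\in\mathbb R$ the sets $M_t$ and $M_{-t}$ are open in $M$, $\phi_t\colon M_t\to M_{-t}$ is a diffeomorphism, and $$\Phi_t\colon q^{-1}(M_t)\to q^{-1}(M_{-t})$$ is an isomorphism of smooth vector bundles over $\phi_t$; that is, $\Phi_t$ is a diffeomorphism with $q\circ\Phi_t=\phi_t\circ q$ on $q^{-1}(M_t)$ whose restriction to each fibre $E_x\to E_{\phi_t(x)}$, $x\in M_t$, is a linear isomorphism. -/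

import Mathlib

open Set Bundle
open scoped Manifold ContDiff

noncomputable section

namespace LinearFlow

section Flow

variable {EM : Type*} [NormedAddCommGroup EM] [NormedSpace ℝ EM]
  {H : Type*} [TopologicalSpace H] {I : ModelWithCorners ℝ EM H}
  {M : Type*} [TopologicalSpace M] [ChartedSpace H M]

/-- `X` is a smooth vector field on the manifold `M`. -/
def IsSmoothVectorField [IsManifold I ∞ M] (X : (x : M) → TangentSpace I x) : Prop :=
  ContMDiff I I.tangent ∞ (fun x => (⟨x, X x⟩ : TangentBundle I M))

/-- `γ` restricts to an integral curve of `X` that starts at `x` at time `0` and is defined on some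
open interval containing both `0` and `t`. (Since only the times `0` and `t` have to be reached,
bounded open intervals suffice.) -/
def IsCurveThrough (X : (x : M) → TangentSpace I x) (t : ℝ) (x : M) (γ : ℝ → M) : Prop :=
  γ 0 = x ∧ ∃ a b : ℝ, (0 : ℝ) ∈ Ioo a b ∧ t ∈ Ioo a b ∧ IsMIntegralCurveOn γ X (Ioo a b)

/-- The maximal flow domain of `X`: all `(t, x)` such that `t` lies in the interval of definition of
the maximal integral curve of `X` through `x` at time `0`. -/
def flowDomain (X : (x : M) → TangentSpace I x) : Set (ℝ × M) :=
  {p | ∃ γ : ℝ → M, IsCurveThrough X p.1 p.2 γ}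

/-- The open set `M_t` of points from which the flow of `X` is defined up to time `t`. -/
def flowSlice (X : (x : M) → TangentSpace I x) (t : ℝ) : Set M :=
  {x | (t, x) ∈ flowDomain X}

open Classical in
/-- The time-`t` map of the maximal flow of `X`: for `(t, x)` in the flow domain it is the value at
`t` of the integral curve of `X` through `x` at time `0` (see `flow_eq`); outside of the flow domain
it has the irrelevant value `x`. -/
def flow (X : (x : M) → TangentSpace I x) (t : ℝ) (x : M) : M :=
  if h : ∃ γ : ℝ → M, IsCurveThrough X t x γ then h.choose t else x

/-- The flow does not depend on the choice of the integral curve. -/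
theorem flow_eq [IsManifold I ∞ M] [BoundarylessManifold I M] [T2Space M]
    {X : (x : M) → TangentSpace I x} (hX : IsSmoothVectorField X) {t : ℝ} {x : M} {γ : ℝ → M}
    (h : IsCurveThrough X t x γ) : flow X t x = γ t := by
  have hex : ∃ γ : ℝ → M, IsCurveThrough X t x γ := ⟨γ, h⟩
  rw [flow, dif_pos hex]
  obtain ⟨h0, a, b, h0m, htm, hc⟩ := hex.choose_spec
  obtain ⟨h0', a', b', h0m', htm', hc'⟩ := h
  have hX1 : ContMDiff I I.tangent 1 (fun x => (⟨x, X x⟩ : TangentBundle I M)) :=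
    ContMDiff.of_le (n := ∞) hX (by norm_cast)
  have sub1 : Ioo (max a a') (min b b') ⊆ Ioo a b :=
    Ioo_subset_Ioo (le_max_left _ _) (min_le_left _ _)
  have sub2 : Ioo (max a a') (min b b') ⊆ Ioo a' b' :=
    Ioo_subset_Ioo (le_max_right _ _) (min_le_right _ _)
  exact isMIntegralCurveOn_Ioo_eqOn_of_contMDiff_boundaryless
    (t₀ := 0) ⟨max_lt h0m.1 h0m'.1, lt_min h0m.2 h0m'.2⟩ hX1 (hc.mono sub1) (hc'.mono sub2)
    (h0.trans h0'.symm) ⟨max_lt htm.1 htm'.1, lt_min htm.2 htm'.2⟩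

/-- `f` restricts to a diffeomorphism from the open subset `U` onto the open subset `V`. -/
def IsDiffeoBetween (I : ModelWithCorners ℝ EM H) (f : M → M) (U V : Set M) : Prop :=
  IsOpen U ∧ IsOpen V ∧ MapsTo f U V ∧ ContMDiffOn I I ∞ f U ∧
    ∃ g : M → M, MapsTo g V U ∧ InvOn g f U V ∧ ContMDiffOn I I ∞ g V

end Flow

section VectorBundle

variable {EM : Type*} [NormedAddCommGroup EM] [NormedSpace ℝ EM]
  {H : Type*} [TopologicalSpace H] (I : ModelWithCorners ℝ EM H)
  {M : Type*} [TopologicalSpace M] [ChartedSpace H M]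
  (F : Type*) [NormedAddCommGroup F] [NormedSpace ℝ F]
  (E : M → Type*) [TopologicalSpace (TotalSpace F E)]
  [∀ x, AddCommGroup (E x)] [∀ x, Module ℝ (E x)] [∀ x, TopologicalSpace (E x)]
  [FiberBundle F E] [VectorBundle ℝ F E]

/-- The first projection `E ×_M E → E`; the fibre product `E ×_M E` is the total space of the
Whitney sum `E ×ᵇ E`. -/
def fstMap (p : TotalSpace (F × F) (E ×ᵇ E)) : TotalSpace F E := ⟨p.proj, p.2.1⟩

/-- The second projection `E ×_M E → E`. -/
def sndMap (p : TotalSpace (F × F) (E ×ᵇ E)) : TotalSpace F E := ⟨p.proj, p.2.2⟩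

/-- The fibrewise addition `+ : E ×_M E → E`. -/
def addMap (p : TotalSpace (F × F) (E ×ᵇ E)) : TotalSpace F E := ⟨p.proj, p.2.1 + p.2.2⟩

/-- The fibrewise multiplication by the scalar `a`, as a map `E → E`. -/
def smulMap (a : ℝ) (p : TotalSpace F E) : TotalSpace F E := ⟨p.proj, a • p.2⟩

variable {F E}

/-- The addition `T+` in the fibres of `Tq : TE → TM`, as a relation: `v₁ +_{TM} v₂ = v`. Here
`v₁, v₂` are tangent vectors to `E` at the points `e₁, e₂` of `E x`. The pair `(v₁, v₂)` is regarded
as a tangent vector `w` to `E ×_M E` at `(e₁, e₂)`, using `T(E ×_M E) = TE ×_{TM} TE`, and `v` is its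
image under the derivative of the addition of `E`. -/
def IsTangentSum {x : M} {e₁ e₂ : E x}
    (v₁ : TangentSpace (I.prod 𝓘(ℝ, F)) (⟨x, e₁⟩ : TotalSpace F E))
    (v₂ : TangentSpace (I.prod 𝓘(ℝ, F)) (⟨x, e₂⟩ : TotalSpace F E))
    (v : TangentSpace (I.prod 𝓘(ℝ, F)) (⟨x, e₁ + e₂⟩ : TotalSpace F E)) : Prop :=
  ∃ w : TangentSpace (I.prod 𝓘(ℝ, F × F)) (⟨x, (e₁, e₂)⟩ : TotalSpace (F × F) (E ×ᵇ E)),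
    mfderiv (I.prod 𝓘(ℝ, F × F)) (I.prod 𝓘(ℝ, F)) (fstMap F E) ⟨x, (e₁, e₂)⟩ w = v₁ ∧
    mfderiv (I.prod 𝓘(ℝ, F × F)) (I.prod 𝓘(ℝ, F)) (sndMap F E) ⟨x, (e₁, e₂)⟩ w = v₂ ∧
    mfderiv (I.prod 𝓘(ℝ, F × F)) (I.prod 𝓘(ℝ, F)) (addMap F E) ⟨x, (e₁, e₂)⟩ w = v

/-- `χ` is a linear vector field on `E` over the vector field `X` on `M`: the map `χ : E → TE` is a
morphism of vector bundles from `q : E → M` to `Tq : TE → TM` over `X : M → TM`. -/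
structure IsLinearVectorField [IsManifold I ∞ M] [ContMDiffVectorBundle ∞ F E I]
    (χ : (e : TotalSpace F E) → TangentSpace (I.prod 𝓘(ℝ, F)) e)
    (X : (x : M) → TangentSpace I x) : Prop where
  smooth : IsSmoothVectorField χ
  smooth_base : IsSmoothVectorField X
  /-- `Tq ∘ χ = X ∘ q` -/
  proj : ∀ e : TotalSpace F E,
    mfderiv (I.prod 𝓘(ℝ, F)) I (π F E) e (χ e) = X e.proj
  /-- `χ (e₁ + e₂) = χ e₁ +_{TM} χ e₂` -/
  add : ∀ (x : M) (e₁ e₂ : E x), IsTangentSum I (χ ⟨x, e₁⟩) (χ ⟨x, e₂⟩) (χ ⟨x, e₁ + e₂⟩)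
  /-- `χ (a e) = a ·_{TM} χ e`, the scalar multiplication `a ·_{TM}` being the derivative of the
  scalar multiplication by `a` on `E` -/
  smul : ∀ (a : ℝ) (x : M) (e : E x),
    χ ⟨x, a • e⟩ =
      mfderiv (I.prod 𝓘(ℝ, F)) (I.prod 𝓘(ℝ, F)) (smulMap F E a) ⟨x, e⟩ (χ ⟨x, e⟩)

/-- `Φ` restricts to an isomorphism of smooth vector bundles from `q⁻¹(U)` onto `q⁻¹(V)` over the
diffeomorphism `f : U → V`. -/
structure IsBundleIsoBetween (Φ : TotalSpace F E → TotalSpace F E) (f : M → M) (U V : Set M) :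
    Prop where
  base : IsDiffeoBetween I f U V
  total : IsDiffeoBetween (I.prod 𝓘(ℝ, F)) Φ (π F E ⁻¹' U) (π F E ⁻¹' V)
  /-- `Φ` covers `f` and is a linear isomorphism from the fibre over `x` to the fibre over `f x` -/
  fibre : ∀ x ∈ U, ∃ L : E x ≃ₗ[ℝ] E (f x), ∀ e : E x, Φ ⟨x, e⟩ = ⟨f x, L e⟩

end VectorBundle

end LinearFlow

end

/-! Two facts carry the theorem: the flow of any smooth vector field has open slices and smooth
time-`t` maps, and the scalar multiplications of `E` commute with the flow of `χ`.

For the first, rescaling time turns the local problem into `α t = x + s ∫₀ᵗ f (α τ) dτ` on `[-1,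
1]`. The superposition operator `α ↦ f ∘ α` is `Cⁿ`, and at `s = 0` the derivative of the equation
in `α` is the identity, so the implicit function theorem gives solutions depending on `x` in a `Cⁿ`
way (`exists_localFlow_of_contDiff`). Charts carry this to manifolds, and connectedness of the time
interval together with the group law `flow_add` propagates it along an integral curve
(`eventually_mem_flowSlice_and_contMDiffAt_flow`).

For the second, `q`, the zero section and multiplication by `a` map integral curves to integral
curves. Hence the integral curve of `χ` through a zero vector lives as long as that of `X`; by
openness so do those through `a • e` for small `a`, and dividing by `a ≠ 0` reaches every `e`
(`mem_flowSlice_iff`). On fibres the flow is homogeneous and differentiable at `0`, hence linear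
(`eq_fderiv_zero_of_homogeneous`); the time `-t` flow inverts it. -/

open scoped Topology

namespace LinearFlow

/-! ### Superposition operators on spaces of continuous maps -/

section Superposition

universe u

variable {K : Type*} [TopologicalSpace K] [CompactSpace K]

/-- Pointwise application of a continuous bilinear map to continuous maps. -/
noncomputable def pointwiseBilin {G E F : Type u} [NormedAddCommGroup G] [NormedSpace ℝ G]
    [NormedAddCommGroup E] [NormedSpace ℝ E] [NormedAddCommGroup F] [NormedSpace ℝ F]
    (B : G →L[ℝ] E →L[ℝ] F) : C(K, G) →L[ℝ] C(K, E) →L[ℝ] C(K, F) :=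
  LinearMap.mkContinuous₂
    (LinearMap.mk₂ ℝ
      (fun (A : C(K, G)) (h : C(K, E)) => (⟨fun t => B (A t) (h t), by fun_prop⟩ : C(K, F)))
      (fun _ _ _ => by ext; simp) (fun _ _ _ => by ext; simp) (fun _ _ _ => by ext; simp)
      (fun _ _ _ => by ext; simp)) ‖B‖ (fun A h => by
        rw [ContinuousMap.norm_le _ (by positivity)]
        intro t
        refine (B.le_opNorm₂ (A t) (h t)).trans ?_
        gcongr
        · exact A.norm_coe_le_norm t
        · exact h.norm_coe_le_norm t)

/-- The superposition operator of a `C¹` map is differentiable. -/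
theorem hasFDerivAt_postcomp {G E F : Type u} [NormedAddCommGroup G] [NormedSpace ℝ G]
    [NormedAddCommGroup E] [NormedSpace ℝ E] [NormedAddCommGroup F] [NormedSpace ℝ F]
    (B : G →L[ℝ] E →L[ℝ] F) (f : C(E, F)) (f' : C(E, G))
    (hf : ∀ x, HasFDerivAt f (B (f' x)) x) (α : C(K, E)) :
    HasFDerivAt (fun β : C(K, E) => f.comp β) (pointwiseBilin B (f'.comp α)) α := by
  rw [hasFDerivAt_iff_isLittleO, Asymptotics.isLittleO_iff]
  intro ε hε
  have hc : ContinuousAt (fun β : C(K, E) => f'.comp β) α :=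
    f'.continuous_postcomp.continuousAt
  obtain ⟨δ, hδ, hball⟩ := Metric.continuousAt_iff.1 hc (ε / (‖B‖ + 1)) (by positivity)
  filter_upwards [Metric.ball_mem_nhds α hδ] with β hβ
  rw [ContinuousMap.norm_le _ (by positivity)]
  intro t
  have hbt : β t ∈ Metric.ball (α t) δ :=
    lt_of_le_of_lt (ContinuousMap.dist_apply_le_dist t) hβ
  have key := (convex_ball (α t) δ).norm_image_sub_le_of_norm_hasFDerivWithin_le'
    (f := f) (f' := fun x => B (f' x)) (φ := B (f' (α t))) (C := ε)
    (fun x _ => (hf x).hasFDerivWithinAt) ?_ (Metric.mem_ball_self hδ) hbt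
  · refine key.trans ?_
    gcongr
    exact (β - α).norm_coe_le_norm t
  · intro z hz
    -- `z` is the value at `t` of `α` shifted by a constant, and the shift is `δ`-close to `α` in
    -- the sup norm. Continuity of `β ↦ f' ∘ β` at `α` thus bounds `f' z - f' (α t)` uniformly in
    -- `t`.
    have hd : dist (α + ContinuousMap.const K (z - α t)) α < δ := by
      rw [dist_eq_norm, add_sub_cancel_left]
      refine lt_of_le_of_lt ((ContinuousMap.norm_le _ (norm_nonneg _)).2 fun _ => ?_)
        (mem_ball_iff_norm.1 hz)
      simp
    have h := lt_of_le_of_lt (ContinuousMap.dist_apply_le_dist t) (hball hd)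
    simp only [dist_eq_norm, ContinuousMap.comp_apply, ContinuousMap.add_apply,
      ContinuousMap.const_apply, add_sub_cancel] at h
    rw [← map_sub]
    calc ‖B (f' z - f' (α t))‖ ≤ ‖B‖ * ‖f' z - f' (α t)‖ := B.le_opNorm _
      _ ≤ (‖B‖ + 1) * (ε / (‖B‖ + 1)) := by gcongr; linarith
      _ = ε := by field_simp

/-- The superposition operator of a `Cⁿ` map is `Cⁿ`. -/
theorem contDiff_postcomp {E : Type u} [NormedAddCommGroup E] [NormedSpace ℝ E] (n : ℕ) :
    ∀ {F : Type u} [NormedAddCommGroup F] [NormedSpace ℝ F] (f : C(E, F)),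
      ContDiff ℝ n f → ContDiff ℝ n (fun β : C(K, E) => f.comp β) := by
  induction n with
  | zero =>
    intro F _ _ f _
    exact contDiff_zero.2 f.continuous_postcomp
  | succ n ih =>
    intro F _ _ f hf
    rw [Nat.cast_add, Nat.cast_one, contDiff_succ_iff_hasFDerivAt] at hf ⊢
    obtain ⟨f', hf', hd⟩ := hf
    -- The induction hypothesis is applied to `f'`, with values in `E →L[ℝ] F`; the shared universe
    -- keeps this space in range.
    exact ⟨_, (pointwiseBilin (ContinuousLinearMap.id ℝ (E →L[ℝ] F))).contDiff.comp
      (ih ⟨f', hf'.continuous⟩ hf'),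
      hasFDerivAt_postcomp (ContinuousLinearMap.id ℝ (E →L[ℝ] F)) f ⟨f', hf'.continuous⟩ hd⟩

end Superposition

/-! ### Local flows on vector spaces by the implicit function theorem -/

section VectorSpaceFlow

variable {E : Type*} [NormedAddCommGroup E] [NormedSpace ℝ E]

omit [NormedSpace ℝ E] in
theorem continuous_extend_symmInterval (α : C(Icc (-1 : ℝ) 1, E)) :
    Continuous fun τ : ℝ => α (projIcc (-1) 1 (by norm_num) τ) :=
  α.continuous.comp continuous_projIcc

/-- The antiderivative vanishing at `0`, as an operator on continuous maps on `[-1, 1]`. -/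
noncomputable def primitiveL : C(Icc (-1 : ℝ) 1, E) →L[ℝ] C(Icc (-1 : ℝ) 1, E) :=
  LinearMap.mkContinuous
    { toFun := fun α => ⟨fun t => ∫ τ in (0 : ℝ)..t, α (projIcc (-1) 1 (by norm_num) τ),
        (intervalIntegral.continuous_primitive
          (fun a b => (continuous_extend_symmInterval α).intervalIntegrable a b) 0).comp
          continuous_subtype_val⟩
      map_add' := fun α β => by
        ext t
        exact intervalIntegral.integral_add
          ((continuous_extend_symmInterval α).intervalIntegrable _ _)
          ((continuous_extend_symmInterval β).intervalIntegrable _ _)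
      map_smul' := fun c α => by
        ext t
        exact intervalIntegral.integral_smul _ _ } 1 (fun α => by
    rw [ContinuousMap.norm_le _ (by positivity)]
    intro t
    refine (intervalIntegral.norm_integral_le_of_norm_le_const (C := ‖α‖)
      fun τ _ => α.norm_coe_le_norm _).trans ?_
    rw [mul_comm, sub_zero]
    gcongr
    exact abs_le.2 t.2)

/-- The map whose zeros are the solutions `α` of `α t = x + s ∫₀ᵗ f (α τ) dτ` on `[-1, 1]`. -/
noncomputable def integralEqn (f : C(E, E)) (p : (E × ℝ) × C(Icc (-1 : ℝ) 1, E)) :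
    C(Icc (-1 : ℝ) 1, E) :=
  p.2 - ContinuousLinearMap.const ℝ _ p.1.1 - p.1.2 • primitiveL (f.comp p.2)

theorem contDiff_integralEqn {n : ℕ} (f : C(E, E)) (hf : ContDiff ℝ n f) :
    ContDiff ℝ n (integralEqn f) := by
  have hx : ContDiff ℝ n fun p : (E × ℝ) × C(Icc (-1 : ℝ) 1, E) =>
      ContinuousLinearMap.const ℝ (Icc (-1 : ℝ) 1) p.1.1 :=
    (ContinuousLinearMap.const ℝ (Icc (-1 : ℝ) 1) : E →L[ℝ] C(Icc (-1 : ℝ) 1, E)).contDiff.comp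
      (contDiff_fst.comp contDiff_fst)
  have hs : ContDiff ℝ n fun p : (E × ℝ) × C(Icc (-1 : ℝ) 1, E) => p.1.2 :=
    contDiff_snd.comp contDiff_fst
  have hp : ContDiff ℝ n fun p : (E × ℝ) × C(Icc (-1 : ℝ) 1, E) => primitiveL (f.comp p.2) :=
    primitiveL.contDiff.comp ((contDiff_postcomp n f hf).comp contDiff_snd)
  exact (contDiff_snd.sub hx).sub (hs.smul hp)

/-- At `s = 0` the integral term drops out, leaving a translation in `α`. This is the invertibility
that the implicit function theorem asks for. -/
theorem fderiv_integralEqn_comp_inr {n : ℕ} (hn : n ≠ 0) (f : C(E, E)) (hf : ContDiff ℝ n f)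
    (x₀ : E) (α : C(Icc (-1 : ℝ) 1, E)) :
    fderiv ℝ (integralEqn f) ((x₀, 0), α) ∘L .inr ℝ (E × ℝ) C(Icc (-1 : ℝ) 1, E) =
      ContinuousLinearMap.id ℝ _ := by
  have h1 : HasFDerivAt (integralEqn f) (fderiv ℝ (integralEqn f) ((x₀, 0), α)) ((x₀, 0), α) :=
    ((contDiff_integralEqn f hf).differentiable (by exact_mod_cast hn) _).hasFDerivAt
  have h2 := h1.comp α (hasFDerivAt_prodMk_right ((x₀, 0) : E × ℝ) α)
  refine h2.unique ?_
  have h3 : integralEqn f ∘ (fun β => (((x₀, 0) : E × ℝ), β)) =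
      fun β => β - ContinuousLinearMap.const ℝ _ x₀ := by
    ext β
    simp [integralEqn]
  rw [h3]
  exact (hasFDerivAt_id α).sub_const _

/-- A global `Cⁿ` vector field on a Banach space has a local flow that is `Cⁿ` in the initial
condition. -/
theorem exists_localFlow_of_contDiff [CompleteSpace E] {n : ℕ} (hn : n ≠ 0) {f : E → E}
    (hf : ContDiff ℝ n f) (x₀ : E) {W : Set E} (hW : W ∈ 𝓝 x₀) :
    ∃ U ∈ 𝓝 x₀, ∃ ε > (0 : ℝ), ∃ Φ : ℝ → E → E, ∀ x ∈ U, Φ 0 x = x ∧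
      ∀ t ∈ Ioo (-ε) ε, Φ t x ∈ W ∧ HasDerivAt (fun τ => Φ τ x) (f (Φ t x)) t ∧
        ContDiffAt ℝ n (Φ t) x := by
  set g : C(E, E) := ⟨f, hf.continuous⟩
  have hgf : ContDiff ℝ n g := hf
  have hn' : (n : WithTop ℕ∞) ≠ 0 := by exact_mod_cast hn
  set α₀ : C(Icc (-1 : ℝ) 1, E) := ContinuousMap.const _ x₀ with hα₀
  set u : (E × ℝ) × C(Icc (-1 : ℝ) 1, E) := ((x₀, 0), α₀) with hu
  have hG : ContDiffAt ℝ n (integralEqn g) u := (contDiff_integralEqn g hgf).contDiffAt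
  have hinv : (fderiv ℝ (integralEqn g) u ∘L
      .inr ℝ (E × ℝ) C(Icc (-1 : ℝ) 1, E)).IsInvertible := by
    rw [hu, fderiv_integralEqn_comp_inr hn g hgf]
    exact ⟨ContinuousLinearEquiv.refl ℝ _, rfl⟩
  set ψ := hG.implicitFunction hn' hinv
  have hψ0 : ψ (x₀, 0) = α₀ := hG.implicitFunction_apply_self hn' hinv
  have hψd : ContDiffAt ℝ n ψ (x₀, 0) := hG.contDiffAt_implicitFunction hn' hinv
  have hψe : ∀ᶠ p in 𝓝 ((x₀, 0) : E × ℝ), integralEqn g (p, ψ p) = 0 := by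
    have hu0 : integralEqn g u = 0 := by
      ext t
      simp [integralEqn, hu, hα₀]
    simpa [hu0] using hG.eventually_apply_implicitFunction hn' hinv
  obtain ⟨δ, hδ, hδW⟩ := Metric.mem_nhds_iff.1 hW
  have hψW : ∀ᶠ p in 𝓝 ((x₀, 0) : E × ℝ), ∀ t, ψ p t ∈ W := by
    have h := hψd.continuousAt.tendsto
    rw [hψ0] at h
    filter_upwards [h (Metric.ball_mem_nhds α₀ hδ)] with p hp t
    exact hδW (lt_of_le_of_lt (ContinuousMap.dist_apply_le_dist (g := α₀) t) hp)
  -- Being `Cⁿ` at a point spreads to a neighbourhood because `n` is finite.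
  have hψd' : ∀ᶠ p in 𝓝 ((x₀, 0) : E × ℝ), ContDiffAt ℝ n ψ p := hψd.eventually (by simp)
  have hall := hψe.and (hψW.and hψd')
  rw [nhds_prod_eq, Filter.eventually_prod_iff] at hall
  obtain ⟨pU, hU, pS, hS, hUS⟩ := hall
  obtain ⟨ε, hε, hεS⟩ := Metric.eventually_nhds_iff.1 hS
  have hs : pS (ε / 2) := hεS (by rw [Real.dist_eq, sub_zero, abs_of_pos] <;> linarith)
  have hs0 : 0 < ε / 2 := by linarith
  -- The parameter is frozen at `s = ε / 2`; the solution on `[-1, 1]` of the equation with factor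
  -- `s` becomes, after `t ↦ t / s`, a solution for `f` on `[-s, s]`.
  refine ⟨{x | pU x}, hU, ε / 2, hs0,
    fun t x => ψ (x, ε / 2) (projIcc (-1) 1 (by norm_num) (t / (ε / 2))), fun x hx => ?_⟩
  generalize ε / 2 = s at *
  obtain ⟨heq, hW', hd⟩ := hUS hx hs
  set α := ψ (x, s) with hα
  have hsol : ∀ t : Icc (-1 : ℝ) 1, α t = x + s • ∫ τ in (0 : ℝ)..t,
      f (α (projIcc (-1) 1 (by norm_num) τ)) := by
    intro t
    have := congrArg (fun β : C(Icc (-1 : ℝ) 1, E) => β t) heq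
    simp only [integralEqn, ContinuousMap.sub_apply,
      ContinuousMap.zero_apply, sub_sub, sub_eq_zero] at this
    exact this
  refine ⟨?_, fun t ht => ⟨hW' _, ?_, ?_⟩⟩
  · change α _ = x
    rw [hsol, projIcc_of_mem (by norm_num) (show 0 / s ∈ Icc (-1 : ℝ) 1 by simp)]
    simp
  · have hmem : ∀ τ ∈ Ioo (-s) s, τ / s ∈ Icc (-1 : ℝ) 1 := fun τ hτ =>
      ⟨by rw [le_div_iff₀ hs0]; linarith [hτ.1], by rw [div_le_iff₀ hs0]; linarith [hτ.2]⟩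
    have hcont : Continuous fun τ : ℝ => f (α (projIcc (-1) 1 (by norm_num) τ)) :=
      hf.continuous.comp (continuous_extend_symmInterval α)
    have h1 : HasDerivAt (fun τ => x + s • ∫ σ in (0 : ℝ)..(τ / s),
        f (α (projIcc (-1) 1 (by norm_num) σ)))
        (s • (s⁻¹ • f (α (projIcc (-1) 1 (by norm_num) (t / s))))) t := by
      have h2 := hcont.integral_hasStrictDerivAt 0 (t / s) |>.hasDerivAt
      have h3 : HasDerivAt (fun τ : ℝ => τ / s) s⁻¹ t := by
        simpa using (hasDerivAt_id t).div_const s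
      exact ((h2.scomp t h3).const_smul s).const_add x
    rw [smul_smul, mul_inv_cancel₀ hs0.ne', one_smul] at h1
    refine h1.congr_of_eventuallyEq ?_
    filter_upwards [Ioo_mem_nhds ht.1 ht.2] with τ hτ
    rw [hsol, projIcc_of_mem _ (hmem τ hτ)]
  · have h1 : ContDiffAt ℝ n (fun y : E => ψ (y, s)) x :=
      hd.comp x (contDiffAt_id.prodMk contDiffAt_const)
    exact (ContinuousMap.evalCLM ℝ _).contDiff.contDiffAt.comp x h1

/-- A `Cⁿ` vector field on a finite-dimensional space has a local flow that is `Cⁿ` in the initial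
condition. -/
theorem exists_localFlow_of_contDiffAt [FiniteDimensional ℝ E] {n : ℕ} (hn : n ≠ 0) {f : E → E}
    {x₀ : E} (hf : ContDiffAt ℝ n f x₀) {W : Set E} (hW : W ∈ 𝓝 x₀) :
    ∃ U ∈ 𝓝 x₀, ∃ ε > (0 : ℝ), ∃ Φ : ℝ → E → E, ∀ x ∈ U, Φ 0 x = x ∧
      ∀ t ∈ Ioo (-ε) ε, Φ t x ∈ W ∧ HasDerivAt (fun τ => Φ τ x) (f (Φ t x)) t ∧
        ContDiffAt ℝ n (Φ t) x := by
  obtain ⟨r, hr, hball⟩ := Metric.eventually_nhds_iff_ball.1 (hf.eventually (by simp))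
  -- The bump is supported in the closed ball of radius `r / 2`, inside the ball of radius `r` on
  -- which `f` is `Cⁿ`, so `b • f` is `Cⁿ` everywhere.
  let b : ContDiffBump x₀ := ⟨r / 4, r / 2, by linarith, by linarith⟩
  have hg : ContDiff ℝ n (fun x => b x • f x) := by
    refine contDiff_iff_contDiffAt.2 fun x => ?_
    by_cases hx : x ∈ Metric.ball x₀ r
    · exact b.contDiffAt.smul (hball x hx)
    · refine (contDiffAt_const (c := (0 : E))).congr_of_eventuallyEq ?_
      have hx' : x ∈ (tsupport b)ᶜ := by
        rw [b.tsupport_eq]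
        intro h
        exact hx (Metric.closedBall_subset_ball (by simp only [b]; linarith) h)
      filter_upwards [(isClosed_tsupport b).isOpen_compl.mem_nhds hx'] with y hy
      simp [image_eq_zero_of_notMem_tsupport hy]
  have : CompleteSpace E := FiniteDimensional.complete ℝ E
  -- Confining the solutions to `b = 1` makes them solutions for `f` itself.
  obtain ⟨U, hU, ε, hε, Φ, hΦ⟩ := exists_localFlow_of_contDiff hn hg x₀
    (Filter.inter_mem hW b.eventuallyEq_one)
  refine ⟨U, hU, ε, hε, Φ, fun x hx => ⟨(hΦ x hx).1, fun t ht => ?_⟩⟩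
  obtain ⟨⟨h1, h2⟩, h3, h4⟩ := (hΦ x hx).2 t ht
  refine ⟨h1, ?_, h4⟩
  have h2' : b (Φ t x) = 1 := h2
  simpa [h2'] using h3

end VectorSpaceFlow

/-! ### Flows on manifolds: group law, openness and smoothness -/

section ManifoldFlow

variable {EM : Type*} [NormedAddCommGroup EM] [NormedSpace ℝ EM]
  {H : Type*} [TopologicalSpace H] {I : ModelWithCorners ℝ EM H}
  {M : Type*} [TopologicalSpace M] [ChartedSpace H M]

/-- A solution of a vector field written in a chart is an integral curve on the manifold. -/
theorem hasMFDerivAt_extChartAt_symm_comp [IsManifold I 1 M] [I.Boundaryless]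
    {X : (x : M) → TangentSpace I x} {x₀ : M} {f : ℝ → EM} {t : ℝ}
    (ht : f t ∈ (extChartAt I x₀).target)
    (hf : HasDerivAt f (tangentCoordChange I ((extChartAt I x₀).symm (f t)) x₀
      ((extChartAt I x₀).symm (f t)) (X ((extChartAt I x₀).symm (f t)))) t) :
    HasMFDerivAt 𝓘(ℝ, ℝ) I ((extChartAt I x₀).symm ∘ f) t
      ((1 : ℝ →L[ℝ] ℝ).smulRight (X ((extChartAt I x₀).symm (f t)))) := by
  set xₜ : M := (extChartAt I x₀).symm (f t) with hxₜ
  have hft1 : xₜ ∈ (extChartAt I x₀).source := (extChartAt I x₀).map_target ht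
  have hft2 := mem_extChartAt_source (I := I) xₜ
  let v : EM := X xₜ
  have key : HasDerivAt ((extChartAt I xₜ ∘ (extChartAt I x₀).symm) ∘ f) v t := by
    have hv : tangentCoordChange I x₀ xₜ xₜ (tangentCoordChange I xₜ x₀ xₜ v) = v := by
      rw [tangentCoordChange_comp ⟨⟨hft2, hft1⟩, hft2⟩, tangentCoordChange_self hft2]
    rw [← hv]
    refine HasFDerivAt.comp_hasDerivAt t ?_ hf
    refine HasFDerivWithinAt.hasFDerivAt (s := range I) ?_ <|
      Filter.mem_of_superset (extChartAt_target_mem_nhds' ht) (extChartAt_target_subset_range x₀)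
    rw [← (extChartAt I x₀).right_inv ht]
    exact hasFDerivWithinAt_tangentCoordChange ⟨hft1, hft2⟩
  refine ⟨(continuousAt_extChartAt_symm'' ht).comp hf.continuousAt, ?_⟩
  have hv : ContinuousLinearMap.toSpanSingleton ℝ v = (1 : ℝ →L[ℝ] ℝ).smulRight v := by
    ext
    simp
  exact (hv ▸ key.hasFDerivAt).hasFDerivWithinAt

/-- A smooth vector field on a manifold has, for every finite `n`, local flows that are `Cⁿ` in the
initial condition. -/
theorem exists_localFlow [FiniteDimensional ℝ EM] [IsManifold I ∞ M] [I.Boundaryless]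
    {X : (x : M) → TangentSpace I x} (hX : IsSmoothVectorField X) {n : ℕ} (hn : n ≠ 0) (x₀ : M) :
    ∃ U : Set M, IsOpen U ∧ x₀ ∈ U ∧ ∃ ε > (0 : ℝ), ∃ Φ : ℝ → M → M, ∀ x ∈ U, Φ 0 x = x ∧
      IsMIntegralCurveOn (fun t => Φ t x) X (Ioo (-ε) ε) ∧
        ∀ t ∈ Ioo (-ε) ε, ContMDiffAt I I n (Φ t) x := by
  have : IsManifold I n M := IsManifold.of_le (n := ∞) (by exact_mod_cast le_top)
  have : IsManifold I 1 M := IsManifold.of_le (n := ∞) (by norm_cast)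
  have hv : ContMDiffAt I I.tangent n (fun x => (⟨x, X x⟩ : TangentBundle I M)) x₀ :=
    (ContMDiff.of_le (n := ∞) hX (by exact_mod_cast le_top)).contMDiffAt
  rw [contMDiffAt_iff] at hv
  have hf : ContDiffAt ℝ n (fun y : EM => tangentCoordChange I ((extChartAt I x₀).symm y) x₀
      ((extChartAt I x₀).symm y) (X ((extChartAt I x₀).symm y))) (extChartAt I x₀ x₀) :=
    (hv.2.contDiffAt (range_mem_nhds_isInteriorPoint
      BoundarylessManifold.isInteriorPoint)).snd
  obtain ⟨U, hU, ε, hε, Ψ, hΨ⟩ := exists_localFlow_of_contDiffAt hn hf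
    (extChartAt_target_mem_nhds (I := I) x₀)
  obtain ⟨V, hVU, hV, hxV⟩ := mem_nhds_iff.1 (Filter.inter_mem
    (extChartAt_source_mem_nhds (I := I) x₀) ((continuousAt_extChartAt x₀).preimage_mem_nhds hU))
  refine ⟨V, hV, hxV, ε, hε, fun t x => (extChartAt I x₀).symm (Ψ t (extChartAt I x₀ x)),
    fun x hx => ?_⟩
  obtain ⟨hxs, hxU⟩ := hVU hx
  obtain ⟨h0, hΨx⟩ := hΨ _ hxU
  refine ⟨?_, fun t ht => ?_, fun t ht => ?_⟩
  · simp only [h0]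
    exact (extChartAt I x₀).left_inv hxs
  · obtain ⟨h1, h2, -⟩ := hΨx t ht
    exact (hasMFDerivAt_extChartAt_symm_comp h1 h2).hasMFDerivWithinAt
  · obtain ⟨h1, -, h3⟩ := hΨx t ht
    have hs : ContMDiffAt 𝓘(ℝ, EM) I n (extChartAt I x₀).symm (Ψ t (extChartAt I x₀ x)) :=
      (contMDiffOn_extChartAt_symm x₀).contMDiffAt (extChartAt_target_mem_nhds' h1)
    have hc : ContMDiffAt I 𝓘(ℝ, EM) n (extChartAt I x₀) x :=
      contMDiffAt_extChartAt' (by rwa [extChartAt_source] at hxs)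
    exact hs.comp x (h3.contMDiffAt.comp x hc)

variable {X : (x : M) → TangentSpace I x}

theorem flow_zero (X : (x : M) → TangentSpace I x) (x : M) : flow X 0 x = x := by
  rw [flow]
  split_ifs with h
  · exact h.choose_spec.1
  -- The default value of `flow` is the starting point.
  · rfl

theorem IsCurveThrough.of_isMIntegralCurveOn {γ : ℝ → M} {a b s t : ℝ}
    (hγ : IsMIntegralCurveOn γ X (Ioo a b)) (hs : s ∈ Ioo a b) (ht : t ∈ Ioo a b) :
    IsCurveThrough X (t - s) (γ s) (γ ∘ (· + s)) := by
  refine ⟨by simp, a - s, b - s, ⟨by linarith [hs.1], by linarith [hs.2]⟩,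
    ⟨by linarith [ht.1], by linarith [ht.2]⟩, (hγ.comp_add s).mono fun r hr => ?_⟩
  exact ⟨by linarith [hr.1], by linarith [hr.2]⟩

theorem IsCurveThrough.mem_flowSlice {γ : ℝ → M} {t : ℝ} {x : M} (h : IsCurveThrough X t x γ) :
    x ∈ flowSlice X t := ⟨γ, h⟩

variable [IsManifold I ∞ M] [I.Boundaryless] [T2Space M]

omit [I.Boundaryless] [T2Space M] in
theorem IsSmoothVectorField.contMDiff_one (hX : IsSmoothVectorField X) :
    ContMDiff I I.tangent 1 (fun x => (⟨x, X x⟩ : TangentBundle I M)) :=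
  ContMDiff.of_le (n := ∞) hX (by norm_cast)

/-- The flow maps `φ_t` satisfy the group law wherever it makes sense. -/
theorem flow_add (hX : IsSmoothVectorField X) {s t : ℝ} {x : M} (hs : x ∈ flowSlice X s)
    (ht : flow X s x ∈ flowSlice X t) :
    x ∈ flowSlice X (s + t) ∧ flow X (s + t) x = flow X t (flow X s x) := by
  obtain ⟨γ₁, h₁⟩ := hs
  rw [flow_eq hX h₁] at ht ⊢
  obtain ⟨γ₂, h₂⟩ := ht
  rw [flow_eq hX h₂]
  obtain ⟨h₁0, a₁, b₁, h₁0m, h₁m, hγ₁⟩ := h₁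
  obtain ⟨h₂0, a₂, b₂, h₂0m, h₂m, hγ₂⟩ := h₂
  simp only at h₁0 h₁m h₂0 h₂m
  have hγ₂' : IsMIntegralCurveOn (γ₂ ∘ (· + -s)) X (Ioo (a₂ + s) (b₂ + s)) :=
    (hγ₂.comp_add (-s)).mono fun r hr => ⟨by linarith [hr.1], by linarith [hr.2]⟩
  have hmem : s ∈ Ioo a₁ b₁ ∩ Ioo (a₂ + s) (b₂ + s) :=
    ⟨h₁m, by linarith [h₂0m.1], by linarith [h₂0m.2]⟩
  have heq : γ₁ s = (γ₂ ∘ (· + -s)) s := by simp [h₂0]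
  have hst : s + t ∈ Ioo (a₂ + s) (b₂ + s) := ⟨by linarith [h₂m.1], by linarith [h₂m.2]⟩
  have hE := eqOn_piecewise_of_isMIntegralCurveOn_Ioo hX.contMDiff_one hγ₁ hγ₂' hmem heq hst
  have hC : IsCurveThrough X (s + t) x (piecewise (Ioo a₁ b₁) γ₁ (γ₂ ∘ (· + -s))) := by
    refine ⟨by rw [piecewise_eq_of_mem _ _ _ h₁0m, h₁0], min a₁ (a₂ + s), max b₁ (b₂ + s),
      ⟨min_lt_of_left_lt h₁0m.1, lt_max_of_lt_left h₁0m.2⟩,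
      ⟨min_lt_of_right_lt hst.1, lt_max_of_lt_right hst.2⟩,
      (isMIntegralCurveOn_piecewise hX.contMDiff_one hγ₁ hγ₂' hmem heq).mono fun r hr => ?_⟩
    -- Both intervals contain `s`, so their union is the whole interval between the outer endpoints.
    obtain ⟨⟨m1, m2⟩, m3, m4⟩ := hmem
    obtain ⟨r1, r2⟩ := hr
    rw [min_lt_iff] at r1
    rw [lt_max_iff] at r2
    rcases le_total r s with h | h
    · rcases r1 with r1 | r1
      · exact Or.inl ⟨r1, by linarith⟩
      · exact Or.inr ⟨r1, by linarith⟩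
    · rcases r2 with r2 | r2
      · exact Or.inl ⟨by linarith, r2⟩
      · exact Or.inr ⟨by linarith, r2⟩
  refine ⟨hC.mem_flowSlice, ?_⟩
  rw [flow_eq hX hC, hE]
  simp

theorem flow_mem_flowSlice_neg (hX : IsSmoothVectorField X) {t : ℝ} {x : M}
    (h : x ∈ flowSlice X t) :
    flow X t x ∈ flowSlice X (-t) ∧ flow X (-t) (flow X t x) = x := by
  obtain ⟨γ, hγ⟩ := h
  rw [flow_eq hX hγ]
  obtain ⟨h0, a, b, h0m, htm, hc⟩ := hγ
  have := IsCurveThrough.of_isMIntegralCurveOn hc htm h0m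
  rw [zero_sub] at this
  refine ⟨this.mem_flowSlice, ?_⟩
  rw [flow_eq hX this]
  simpa using h0

variable [FiniteDimensional ℝ EM]

omit [T2Space M] in
theorem flowSlice_zero (hX : IsSmoothVectorField X) : flowSlice X 0 = univ := by
  refine eq_univ_of_forall fun x => ?_
  obtain ⟨U, -, hxU, ε, hε, Φ, hΦ⟩ := exists_localFlow hX one_ne_zero x
  obtain ⟨h0, hc, -⟩ := hΦ x hxU
  exact ⟨fun t => Φ t x, h0, -ε, ε, ⟨by linarith, hε⟩, ⟨by simpa using hε, hε⟩, hc⟩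

/-- Near a point of its domain, the time-`t` map of the flow is defined and `Cⁿ`. -/
theorem eventually_mem_flowSlice_and_contMDiffAt_flow (hX : IsSmoothVectorField X) {n : ℕ}
    (hn : n ≠ 0) {t : ℝ} {x : M} (h : x ∈ flowSlice X t) :
    (∀ᶠ y in 𝓝 x, y ∈ flowSlice X t) ∧ ContMDiffAt I I n (flow X t) x := by
  obtain ⟨γ, hγ0, a, b, h0m, htm, hγ⟩ := h
  simp only at hγ0 htm
  let P : ℝ → Prop := fun s =>
    (∀ᶠ y in 𝓝 x, y ∈ flowSlice X s) ∧ ContMDiffAt I I n (flow X s) x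
  have hflow : ∀ s ∈ Ioo a b, flow X s x = γ s := fun s hs =>
    flow_eq hX ⟨hγ0, a, b, h0m, hs, hγ⟩
  have step : ∀ {U : Set M} {ε : ℝ} {Φ : ℝ → M → M}, IsOpen U → 0 < ε →
      (∀ y ∈ U, Φ 0 y = y ∧ IsMIntegralCurveOn (fun t => Φ t y) X (Ioo (-ε) ε) ∧
        ∀ t ∈ Ioo (-ε) ε, ContMDiffAt I I n (Φ t) y) →
      ∀ s s', s ∈ Ioo a b → γ s ∈ U → s' - s ∈ Ioo (-ε) ε → P s → P s' := by
    intro U ε Φ hU hε hΦ s s' hs hsU hr hP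
    have hev : ∀ᶠ y in 𝓝 x, y ∈ flowSlice X s' ∧ flow X s' y = Φ (s' - s) (flow X s y) := by
      have hnb : U ∈ 𝓝 (flow X s x) := hflow s hs ▸ hU.mem_nhds hsU
      filter_upwards [hP.1, hP.2.continuousAt.preimage_mem_nhds hnb] with y hy hyU
      obtain ⟨h0, hc, -⟩ := hΦ _ hyU
      have hC : IsCurveThrough X (s' - s) (flow X s y) (fun t => Φ t (flow X s y)) :=
        ⟨h0, -ε, ε, ⟨by linarith, hε⟩, hr, hc⟩
      have := flow_add hX hy hC.mem_flowSlice
      rwa [add_sub_cancel, flow_eq hX hC] at this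
    refine ⟨hev.mono fun y hy => hy.1, ?_⟩
    refine ContMDiffAt.congr_of_eventuallyEq ?_ (hev.mono fun y hy => hy.2)
    have := (hΦ _ hsU).2.2 _ hr
    rw [← hflow s hs] at this
    exact this.comp x hP.2
  have hP0 : P 0 := by
    refine ⟨by simp [flowSlice_zero hX], ?_⟩
    rw [show flow X 0 = id from funext (flow_zero X)]
    exact contMDiffAt_id
  -- Connectedness requires `P` to pass between nearby times in both directions; one local flow
  -- around `γ s` serves for both.
  refine isPreconnected_Ioo.induction₂' (fun s s' => P s → P s') (fun s hs => ?_)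
    (fun _ _ _ _ _ _ h h' => h' ∘ h) h0m htm hP0
  obtain ⟨U, hU, hsU, ε, hε, Φ, hΦ⟩ := exists_localFlow hX hn (γ s)
  rw [isOpen_Ioo.nhdsWithin_eq hs]
  have hcont : ContinuousAt γ s :=
    (hγ.continuousWithinAt hs).continuousAt (isOpen_Ioo.mem_nhds hs)
  filter_upwards [hcont.preimage_mem_nhds (hU.mem_nhds hsU), isOpen_Ioo.mem_nhds hs,
    Metric.ball_mem_nhds s hε] with s' hs'U hs' hd
  rw [Metric.mem_ball, Real.dist_eq, abs_lt] at hd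
  exact ⟨step hU hε hΦ s s' hs hsU ⟨hd.1, hd.2⟩,
    step hU hε hΦ s' s hs' hs'U ⟨by linarith [hd.2], by linarith [hd.1]⟩⟩

theorem isOpen_flowSlice (hX : IsSmoothVectorField X) (t : ℝ) : IsOpen (flowSlice X t) :=
  isOpen_iff_mem_nhds.2 fun _ hx =>
    (eventually_mem_flowSlice_and_contMDiffAt_flow hX one_ne_zero hx).1

theorem contMDiffAt_flow (hX : IsSmoothVectorField X) {t : ℝ} {x : M}
    (hx : x ∈ flowSlice X t) : ContMDiffAt I I ∞ (flow X t) x := by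
  refine contMDiffAt_infty.2 fun n => ?_
  -- Order `n + 1` is used because the local result needs a nonzero order.
  exact (eventually_mem_flowSlice_and_contMDiffAt_flow hX n.succ_ne_zero hx).2.of_le
    (by exact_mod_cast n.le_succ)

/-- The time-`t` map of the flow is a diffeomorphism from `M_t` onto `M_{-t}`. -/
theorem isDiffeoBetween_flow (hX : IsSmoothVectorField X) (t : ℝ) :
    IsDiffeoBetween I (flow X t) (flowSlice X t) (flowSlice X (-t)) := by
  refine ⟨isOpen_flowSlice hX t, isOpen_flowSlice hX (-t),
    fun x hx => (flow_mem_flowSlice_neg hX hx).1,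
    fun x hx => (contMDiffAt_flow hX hx).contMDiffWithinAt, flow X (-t), fun x hx => ?_,
    ⟨fun x hx => (flow_mem_flowSlice_neg hX hx).2, fun x hx => ?_⟩,
    fun x hx => (contMDiffAt_flow hX hx).contMDiffWithinAt⟩
  · simpa using (flow_mem_flowSlice_neg hX hx).1
  · simpa using (flow_mem_flowSlice_neg hX hx).2

end ManifoldFlow

/-! ### Related vector fields, Hausdorff total spaces, homogeneous maps -/

section Related

variable {E₁ : Type*} [NormedAddCommGroup E₁] [NormedSpace ℝ E₁]
  {H₁ : Type*} [TopologicalSpace H₁] {I₁ : ModelWithCorners ℝ E₁ H₁}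
  {M₁ : Type*} [TopologicalSpace M₁] [ChartedSpace H₁ M₁]
  {E₂ : Type*} [NormedAddCommGroup E₂] [NormedSpace ℝ E₂]
  {H₂ : Type*} [TopologicalSpace H₂] {I₂ : ModelWithCorners ℝ E₂ H₂}
  {M₂ : Type*} [TopologicalSpace M₂] [ChartedSpace H₂ M₂]

/-- `f` maps curves through `x` to curves through `f x` if it intertwines the vector fields. -/
theorem IsCurveThrough.map {X₁ : (x : M₁) → TangentSpace I₁ x} {X₂ : (x : M₂) → TangentSpace I₂ x}
    {f : M₁ → M₂} (hf : MDifferentiable I₁ I₂ f)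
    (hX : ∀ x, mfderiv I₁ I₂ f x (X₁ x) = X₂ (f x)) {t : ℝ} {x : M₁} {γ : ℝ → M₁}
    (h : IsCurveThrough X₁ t x γ) : IsCurveThrough X₂ t (f x) (f ∘ γ) := by
  obtain ⟨h0, a, b, h0m, htm, hc⟩ := h
  refine ⟨congrArg f h0, a, b, h0m, htm, fun s hs => ?_⟩
  refine (HasMFDerivAt.comp_hasMFDerivWithinAt s (hf (γ s)).hasMFDerivAt (hc s hs)).congr_mfderiv ?_
  refine ContinuousLinearMap.ext fun r : ℝ => ?_
  change mfderiv I₁ I₂ f (γ s) (r • X₁ (γ s)) = r • X₂ (f (γ s))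
  rw [map_smul, hX]

end Related

/-- The total space of a fibre bundle with Hausdorff base and fibre is Hausdorff. -/
theorem t2Space_totalSpace {M : Type*} [TopologicalSpace M] [T2Space M] {F : Type*}
    [TopologicalSpace F] [T2Space F] {E : M → Type*} [TopologicalSpace (TotalSpace F E)]
    [∀ x, TopologicalSpace (E x)] [FiberBundle F E] :
    T2Space (TotalSpace F E) := by
  refine t2_iff_nhds.2 fun {x y} h => ?_
  have hx : 𝓝 x ⊓ 𝓝 y ≤ 𝓝 x := inf_le_left
  have hy : 𝓝 x ⊓ 𝓝 y ≤ 𝓝 y := inf_le_right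
  have hπ := FiberBundle.continuous_proj F E
  have hproj : x.proj = y.proj :=
    tendsto_nhds_unique ((hπ.tendsto x).mono_left hx) ((hπ.tendsto y).mono_left hy)
  set e := trivializationAt F E x.proj with he
  have hxs : x ∈ e.source := e.mem_source.2 (FiberBundle.mem_baseSet_trivializationAt' _)
  have hys : y ∈ e.source :=
    e.mem_source.2 (hproj ▸ FiberBundle.mem_baseSet_trivializationAt' _)
  refine e.injOn hxs hys (tendsto_nhds_unique (l := 𝓝 x ⊓ 𝓝 y) (f := e) ?_ ?_)
  · exact (e.continuousAt hxs).tendsto.mono_left hx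
  · exact (e.continuousAt hys).tendsto.mono_left hy

/-- A homogeneous map that is differentiable at the origin is linear. -/
theorem eq_fderiv_zero_of_homogeneous {F F' : Type*} [NormedAddCommGroup F]
    [NormedSpace ℝ F] [NormedAddCommGroup F'] [NormedSpace ℝ F']
    {h : F → F'} (hd : DifferentiableAt ℝ h 0) (hs : ∀ (a : ℝ) v, h (a • v) = a • h v) (v : F) :
    h v = fderiv ℝ h 0 v := by
  have h1 : HasDerivAt (fun a : ℝ => h (a • v)) (fderiv ℝ h 0 v) 0 := by
    have h2 : HasDerivAt (fun a : ℝ => a • v) v 0 := by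
      simpa using (hasDerivAt_id (0 : ℝ)).smul_const v
    refine HasFDerivAt.comp_hasDerivAt (0 : ℝ) ?_ h2
    rw [zero_smul]
    exact hd.hasFDerivAt
  have h3 : HasDerivAt (fun a : ℝ => h (a • v)) (h v) 0 := by
    simp only [hs]
    simpa using (hasDerivAt_id (0 : ℝ)).smul_const (h v)
  exact h3.unique h1

/-! ### Flows of linear vector fields -/

section LinearVectorField

variable {EM : Type*} [NormedAddCommGroup EM] [NormedSpace ℝ EM]
  {H : Type*} [TopologicalSpace H] {I : ModelWithCorners ℝ EM H}
  {M : Type*} [TopologicalSpace M] [ChartedSpace H M]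
  {F : Type*} [NormedAddCommGroup F] [NormedSpace ℝ F]
  {E : M → Type*} [TopologicalSpace (TotalSpace F E)]
  [∀ x, AddCommGroup (E x)] [∀ x, Module ℝ (E x)] [∀ x, TopologicalSpace (E x)]
  [FiberBundle F E] [VectorBundle ℝ F E]

theorem continuous_smul_fibre {x : M} (e : E x) :
    Continuous fun a : ℝ => (⟨x, a • e⟩ : TotalSpace F E) := by
  let T := VectorBundle.continuousLinearEquivAt ℝ F E x
  have h : (fun a : ℝ => a • e) = fun a : ℝ => T.symm (a • T e) := by
    ext a
    simp
  refine (FiberBundle.continuous_totalSpaceMk F E x).comp (?_ : Continuous fun a : ℝ => a • e)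
  rw [h]
  exact T.symm.continuous.comp (by fun_prop)

variable [IsManifold I ∞ M] [ContMDiffVectorBundle ∞ F E I]

omit [IsManifold I ∞ M] [ContMDiffVectorBundle ∞ F E I] in
theorem contMDiff_smulMap (a : ℝ) :
    ContMDiff (I.prod 𝓘(ℝ, F)) (I.prod 𝓘(ℝ, F)) ∞ (smulMap F E a) := by
  intro p
  have hid : ContMDiffAt (I.prod 𝓘(ℝ, F)) (I.prod 𝓘(ℝ, F)) ∞ (id : TotalSpace F E → _) p :=
    contMDiffAt_id
  rw [contMDiffAt_totalSpace] at hid ⊢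
  refine ⟨hid.1, ((contMDiffAt_const (I' := 𝓘(ℝ, ℝ)) (c := a)).smul hid.2).congr_of_eventuallyEq ?_⟩
  have hb : (trivializationAt F E p.proj).baseSet ∈ 𝓝 p.proj :=
    (trivializationAt F E p.proj).open_baseSet.mem_nhds
      (FiberBundle.mem_baseSet_trivializationAt' _)
  filter_upwards [(FiberBundle.continuous_proj F E).continuousAt.preimage_mem_nhds hb] with y hy
  exact ((trivializationAt F E p.proj).linear ℝ hy).2 a y.2

variable {χ : (e : TotalSpace F E) → TangentSpace (I.prod 𝓘(ℝ, F)) e}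
  {X : (x : M) → TangentSpace I x}

/-- Multiplication by `0` is the zero section after `q`; differentiating this and using homogeneity
of `χ` for `a = 0` shows that the zero section intertwines `X` and `χ`. -/
theorem IsLinearVectorField.mfderiv_zeroSection (hχ : IsLinearVectorField I χ X) (x : M) :
    mfderiv I (I.prod 𝓘(ℝ, F)) (zeroSection F E) x (X x) = χ (zeroSection F E x) := by
  have hz : MDifferentiable I (I.prod 𝓘(ℝ, F)) (zeroSection F E) :=
    (contMDiff_zeroSection (n := ∞) ℝ E).mdifferentiable (by simp)
  have hπ : MDifferentiable (I.prod 𝓘(ℝ, F)) I (π F E) :=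
    (contMDiff_proj (n := ∞) E).mdifferentiable (by simp)
  have hs : smulMap F E 0 = zeroSection F E ∘ π F E := by
    ext1 p
    exact congrArg (TotalSpace.mk p.proj) (zero_smul ℝ p.2)
  have h1 : HasMFDerivAt (I.prod 𝓘(ℝ, F)) (I.prod 𝓘(ℝ, F)) (zeroSection F E ∘ π F E)
      (⟨x, 0⟩ : TotalSpace F E) _ :=
    HasMFDerivAt.comp _ (hz x).hasMFDerivAt (hπ ⟨x, 0⟩).hasMFDerivAt
  rw [← hs] at h1
  have h2 := hχ.smul 0 x 0
  rw [h1.mfderiv] at h2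
  -- The tangent spaces at `0 • 0` and at `0` are different types; both unfold to `EM × F`, where
  -- the vectors can be compared.
  have h3 : (χ ⟨x, (0 : ℝ) • (0 : E x)⟩ : EM × F) = χ (zeroSection F E x) :=
    congrArg (fun v : E x => (χ ⟨x, v⟩ : EM × F)) (zero_smul ℝ (0 : E x))
  refine Eq.trans ?_ (h2.symm.trans h3)
  exact congrArg (mfderiv I (I.prod 𝓘(ℝ, F)) (zeroSection F E) x)
    (hχ.proj (zeroSection F E x)).symm

variable {t : ℝ} {γ : ℝ → TotalSpace F E}

theorem IsLinearVectorField.isCurveThrough_proj (hχ : IsLinearVectorField I χ X)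
    {e : TotalSpace F E} (h : IsCurveThrough χ t e γ) :
    IsCurveThrough X t e.proj (π F E ∘ γ) :=
  h.map (f := π F E) ((contMDiff_proj (n := ∞) E).mdifferentiable (by simp)) hχ.proj

theorem IsLinearVectorField.isCurveThrough_smulMap (hχ : IsLinearVectorField I χ X) (a : ℝ)
    {e : TotalSpace F E} (h : IsCurveThrough χ t e γ) :
    IsCurveThrough χ t (smulMap F E a e) (smulMap F E a ∘ γ) :=
  h.map ((contMDiff_smulMap a).mdifferentiable (by simp))
    fun p => (hχ.smul a p.proj p.2).symm

variable [I.Boundaryless] [T2Space M]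

theorem IsLinearVectorField.proj_flow (hχ : IsLinearVectorField I χ X) {e : TotalSpace F E}
    (he : e ∈ flowSlice χ t) : (flow χ t e).proj = flow X t e.proj := by
  have : T2Space (TotalSpace F E) := t2Space_totalSpace
  obtain ⟨γ, hγ⟩ := he
  rw [flow_eq hχ.smooth hγ, flow_eq hχ.smooth_base (hχ.isCurveThrough_proj hγ)]
  rfl

theorem IsLinearVectorField.flow_smulMap (hχ : IsLinearVectorField I χ X) (a : ℝ)
    {e : TotalSpace F E} (he : e ∈ flowSlice χ t) :
    flow χ t (smulMap F E a e) = smulMap F E a (flow χ t e) := by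
  have : T2Space (TotalSpace F E) := t2Space_totalSpace
  obtain ⟨γ, hγ⟩ := he
  rw [flow_eq hχ.smooth hγ, flow_eq hχ.smooth (hχ.isCurveThrough_smulMap a hγ)]
  rfl

variable [FiniteDimensional ℝ EM] [FiniteDimensional ℝ F]

/-- Projection gives one direction. For the other, the zero vector over `x` flows up to time `t`,
openness of the slice extends this to `a • e` for some `a ≠ 0`, and scaling by `a⁻¹` returns to `e`.
-/
theorem IsLinearVectorField.mem_flowSlice_iff (hχ : IsLinearVectorField I χ X) (t : ℝ)
    (e : TotalSpace F E) : e ∈ flowSlice χ t ↔ e.proj ∈ flowSlice X t := by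
  have : T2Space (TotalSpace F E) := t2Space_totalSpace
  constructor
  · rintro ⟨γ, hγ⟩
    exact (hχ.isCurveThrough_proj hγ).mem_flowSlice
  · rintro ⟨γ, hγ⟩
    obtain ⟨x, e⟩ := e
    have h0 : zeroSection F E x ∈ flowSlice χ t :=
      (hγ.map (f := zeroSection F E) ((contMDiff_zeroSection (n := ∞) ℝ E).mdifferentiable
        (by simp)) hχ.mfderiv_zeroSection).mem_flowSlice
    have hnear : ∀ᶠ a in 𝓝 (0 : ℝ), (⟨x, a • e⟩ : TotalSpace F E) ∈ flowSlice χ t := by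
      refine (continuous_smul_fibre (F := F) e).continuousAt.preimage_mem_nhds
        ((isOpen_flowSlice hχ.smooth t).mem_nhds ?_)
      rw [zero_smul]
      exact h0
    obtain ⟨a, ⟨γ', hγ'⟩, ha⟩ := ((hnear.filter_mono nhdsWithin_le_nhds).and
      (self_mem_nhdsWithin (s := {(0 : ℝ)}ᶜ))).exists
    have := (hχ.isCurveThrough_smulMap a⁻¹ hγ').mem_flowSlice
    rwa [smulMap, smul_smul, inv_mul_cancel₀ ha, one_smul] at this

/-- The flow of a linear vector field is linear on the fibres. -/
theorem IsLinearVectorField.exists_linearMap_flow (hχ : IsLinearVectorField I χ X) {x : M}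
    (hx : x ∈ flowSlice X t) :
    ∃ L : E x →ₗ[ℝ] E (flow X t x), ∀ e : E x, flow χ t ⟨x, e⟩ = ⟨flow X t x, L e⟩ := by
  have : T2Space (TotalSpace F E) := t2Space_totalSpace
  have hmem : ∀ e : E x, (⟨x, e⟩ : TotalSpace F E) ∈ flowSlice χ t := fun e =>
    (hχ.mem_flowSlice_iff t ⟨x, e⟩).2 hx
  have hL : ∀ e : E x, ∃ l : E (flow X t x), flow χ t ⟨x, e⟩ = ⟨flow X t x, l⟩ := by
    intro e
    have h := hχ.proj_flow (hmem e)
    generalize flow χ t ⟨x, e⟩ = p at h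
    obtain ⟨y, l⟩ := p
    simp only at h
    subst h
    exact ⟨l, rfl⟩
  choose L hL using hL
  have hsmul : ∀ (a : ℝ) (e : E x), L (a • e) = a • L e := by
    intro a e
    have h := hχ.flow_smulMap a (hmem e)
    rw [hL, smulMap, smulMap, hL] at h
    exact TotalSpace.mk_injective _ h
  let S := VectorBundle.continuousLinearEquivAt ℝ F E x
  let T := VectorBundle.continuousLinearEquivAt ℝ F E (flow X t x)
  -- In the trivializations at `x` and at `flow X t x`, the fibre map is the smooth flow restricted
  -- to one fibre.
  have hd : DifferentiableAt ℝ (fun v : F => T (L (S.symm v))) 0 := by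
    have hin : ContMDiffAt 𝓘(ℝ, F) (I.prod 𝓘(ℝ, F)) ∞
        (fun v : F => (⟨x, S.symm v⟩ : TotalSpace F E)) 0 := by
      rw [contMDiffAt_totalSpace]
      refine ⟨contMDiffAt_const, ?_⟩
      refine contMDiffAt_id.congr_of_eventuallyEq (Filter.Eventually.of_forall fun v => ?_)
      exact S.apply_symm_apply v
    have hout := (contMDiffAt_flow hχ.smooth (hmem (S.symm 0))).comp (0 : F) hin
    rw [contMDiffAt_totalSpace] at hout
    have h := hout.2.contDiffAt.differentiableAt (by simp)
    refine h.congr_of_eventuallyEq (Filter.Eventually.of_forall fun v => ?_)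
    simp only [Function.comp_apply, hL]
    rfl
  have hlin := eq_fderiv_zero_of_homogeneous hd (fun a v => by simp [hsmul])
  have hadd : ∀ e₁ e₂ : E x, L (e₁ + e₂) = L e₁ + L e₂ := by
    intro e₁ e₂
    have h := fun e : E x => hlin (S e)
    simp only [ContinuousLinearEquiv.symm_apply_apply] at h
    apply T.injective
    rw [map_add, h, h, h, map_add, map_add]
  exact ⟨{ toFun := L, map_add' := hadd, map_smul' := hsmul }, hL⟩

end LinearVectorField

end LinearFlow

/-! ### The flow as a bundle isomorphism -/

theorem theorem3p1
    {EM : Type*} [NormedAddCommGroup EM] [NormedSpace ℝ EM] [FiniteDimensional ℝ EM]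
    {H : Type*} [TopologicalSpace H] (I : ModelWithCorners ℝ EM H) [I.Boundaryless]
    {M : Type*} [TopologicalSpace M] [ChartedSpace H M] [IsManifold I ∞ M] [T2Space M]
    {F : Type*} [NormedAddCommGroup F] [NormedSpace ℝ F] [FiniteDimensional ℝ F]
    {E : M → Type*} [TopologicalSpace (TotalSpace F E)]
    [∀ x, AddCommGroup (E x)] [∀ x, Module ℝ (E x)] [∀ x, TopologicalSpace (E x)]
    [FiberBundle F E] [VectorBundle ℝ F E] [ContMDiffVectorBundle ∞ F E I]
    (χ : (e : TotalSpace F E) → TangentSpace (I.prod 𝓘(ℝ, F)) e)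
    (X : (x : M) → TangentSpace I x)
    (hχ : LinearFlow.IsLinearVectorField I χ X) :
    LinearFlow.flowDomain χ =
        {p : ℝ × TotalSpace F E | (p.1, p.2.proj) ∈ LinearFlow.flowDomain X} ∧
      ∀ t : ℝ,
        LinearFlow.IsBundleIsoBetween I (LinearFlow.flow χ t) (LinearFlow.flow X t)
          (LinearFlow.flowSlice X t) (LinearFlow.flowSlice X (-t)) := by
  have : T2Space (TotalSpace F E) := LinearFlow.t2Space_totalSpace
  refine ⟨Set.ext fun p => hχ.mem_flowSlice_iff p.1 p.2, fun t =>
    ⟨LinearFlow.isDiffeoBetween_flow hχ.smooth_base t, ?_, fun x hx => ?_⟩⟩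
  · have hpre : ∀ s : ℝ, π F E ⁻¹' LinearFlow.flowSlice X s = LinearFlow.flowSlice χ s :=
      fun s => Set.ext fun e => (hχ.mem_flowSlice_iff s e).symm
    rw [hpre, hpre]
    exact LinearFlow.isDiffeoBetween_flow hχ.smooth t
  · obtain ⟨L, hL⟩ := hχ.exists_linearMap_flow hx
    obtain ⟨hx', hback⟩ := LinearFlow.flow_mem_flowSlice_neg hχ.smooth_base hx
    have hinv : ∀ {s : ℝ} (e : TotalSpace F E), e.proj ∈ LinearFlow.flowSlice X s →
        LinearFlow.flow χ (-s) (LinearFlow.flow χ s e) = e := fun e he =>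
      (LinearFlow.flow_mem_flowSlice_neg hχ.smooth ((hχ.mem_flowSlice_iff _ e).2 he)).2
    refine ⟨LinearEquiv.ofBijective L ⟨fun e₁ e₂ h => ?_, fun l => ?_⟩, hL⟩
    · refine TotalSpace.mk_injective (F := F) x ?_
      rw [← hinv (⟨x, e₁⟩ : TotalSpace F E) hx, ← hinv (⟨x, e₂⟩ : TotalSpace F E) hx, hL, hL, h]
    · obtain ⟨L', hL'⟩ := hχ.exists_linearMap_flow hx'
      have h := hinv (⟨LinearFlow.flow X t x, l⟩ : TotalSpace F E) hx'
      rw [neg_neg, hL'] at h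
      -- Flowing back ends in the fibre over `flow X (-t) (flow X t x)`, which equals `x` only
      -- propositionally, so the vector has to be transported to `E x`.
      have hcast : ∀ y, y = x → ∀ v : E y, ∃ e : E x, (⟨y, v⟩ : TotalSpace F E) = ⟨x, e⟩ := by
        rintro _ rfl v
        exact ⟨v, rfl⟩
      obtain ⟨e, he⟩ := hcast _ hback (L' l)
      rw [he] at h
      exact ⟨e, TotalSpace.mk_injective (F := F) _ ((hL e).symm.trans h)⟩
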